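/- For an irrational number $x\in[0,1)$ let $x=[a_1(x),a_2(x),\dots]$ be its continued fraction expansion, i.e. $a_n(x)=\lfloor 1/T^{n-1}(x)\rfloor$ for $n\ge 1$, where $T$ is the Gauss map $T(0)=0$, $T(x)=1/x \pmod 1$ for $x\in(0,1)$. Let $\varphi:\mathbb{N}\to[0,\infty)$ satisfy $\varphi(n)/n\to\infty$ as $n\to\infty$, and let $$\log B=\limsup_{n\to\infty}\frac{\log\varphi(n)}{n},\qquad B\in[1,\infty]$$ (with $\log\infty=\infty$). Then for every integer $m\ge 0$ and all real weights $t_0,\dots,t_m\ge 0$, not all zero, the set $$\underline{E}(\{t_i\}_{i=0}^m,\varphi)=\left\{x\in[0,1)\setminus\mathbb{Q}:\ \liminf_{n\to\infty}\frac{\log\left(a_n(x)^{t_0}a_{n+1}(x)^{t_1}\cdots a_{n+m}(x)^{t_m}\right)}{\varphi(n)}=1\right\}$$ has Hausdorff dimension $$\dim_H\underline{E}(\{t_i\}_{i=0}^m,\varphi)=\frac{1}{1+B},$$ where $1/(1+\infty)=0$. -/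

import Mathlib

open Filter Set

/-- The Gauss map `T x = 1 / x (mod 1)`; the convention `1 / 0 = 0` gives `T 0 = 0`. -/
noncomputable def gaussMap (x : ℝ) : ℝ := Int.fract (1 / x)

/-- The `n`-th partial quotient `a_n(x) = ⌊1 / T^{n-1}(x)⌋` of `x ∈ [0,1)`, for `n ≥ 1`.
(The value at `n = 0` is not meaningful.) -/
noncomputable def partialQuotient (n : ℕ) (x : ℝ) : ℤ := ⌊1 / gaussMap^[n - 1] x⌋

/-- The weighted product `a_n(x)^{t_0} a_{n+1}(x)^{t_1} ⋯ a_{n+m}(x)^{t_m}`. -/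
noncomputable def weightedProduct {m : ℕ} (t : Fin (m + 1) → ℝ) (n : ℕ) (x : ℝ) : ℝ :=
  ∏ i : Fin (m + 1), (partialQuotient (n + (i : ℕ)) x : ℝ) ^ t i

/-- The set of (irrational) `x ∈ [0,1)` such that the limit inferior (in `[-∞, ∞]`) of
`log (a_n(x)^{t_0} ⋯ a_{n+m}(x)^{t_m}) / φ(n)` equals `1`. -/
def liminfSet {m : ℕ} (t : Fin (m + 1) → ℝ) (φ : ℕ → ℝ) : Set ℝ :=
  {x | x ∈ Ico (0 : ℝ) 1 ∧ Irrational x ∧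
    liminf (fun n : ℕ => ((Real.log (weightedProduct t n x) / φ n : ℝ) : EReal)) atTop = 1}

/-!
The dimension is computed from the products `Q_p = a_1 ⋯ a_p` of the partial quotients. If `x` and
`y` share their first `p` partial quotients, then `|x - y|` equals `|T^p x - T^p y|` times the
product of `T^j x * T^j y` over `j < p` (`abs_sub_eq_of_partialQuotient_eq`), and each `T^j x` is
comparable to `1 / a_{j+1}`. Both bounds rest on this identity.

Upper bound. For `x` in the set, the weighted products are eventually at least `exp (φ n / 2)`, so
`log Q_p` grows faster than any linear function of `p`, because `φ n / n → ∞`, and it is not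
`O (c ^ p)` for any `c < B`. Hence `Q_{p+1} ≥ Q_p ^ c` for infinitely many `p`; for `c = 1` this
is trivial. The points with given first `p` partial quotients and `a_{p+1} ≥ Q_p ^ (c - 1)` form a
set of diameter at most `Q_p ^ (-(1 + c))`. The sum of `Q_p ^ (-σ)` over all choices of `p` digits
is the `p`-th power of a convergent series when `σ > 1`, and the restriction `Q_p ≥ exp (K p)` with
`K` large turns the sum over `p` into a convergent geometric series
(`dimH_le_of_frequently_large`). This gives dimension at most `1 / (1 + c)`.

Lower bound. Let `b > B` and let `M k` be the supremum of `φ n / b ^ n` over `n ≥ k`. The rate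
`ψ n = b ^ n * M (n - m)` satisfies `φ n ≤ ψ n` and `ψ (n + 1) ≤ b ψ n`. The weighted sums of `ψ`,
divided by `φ`, have a positive limit inferior, and it is finite since `M` decreases at most
exponentially (`frequently_tailSup_le`); dividing `ψ` by it yields limit inferior `1`
(`exists_digit_growth`). All irrational `x` with `u n ≤ a_{n+1} < 2 u n`, where `u n` is
`exp (ψ (n + 1))` rounded up, then belong to the set. Writing `y ∈ [0, 1)` in the mixed radix `u`
and adding its digits to `u` gives such an `x`. The inverse map is Hölder continuous with any
exponent below `1 / (1 + b)`, so the dimension is at least `1 / (1 + b)` (`le_dimH_of_digits`).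
-/

/-! ### The Gauss map and the digits of irrational numbers -/

theorem partialQuotient_succ (n : ℕ) (x : ℝ) :
    partialQuotient (n + 1) x = ⌊1 / gaussMap^[n] x⌋ := rfl

theorem irrational_gaussMap {x : ℝ} (hx : Irrational x) : Irrational (gaussMap x) := by
  unfold gaussMap Int.fract
  rw [one_div]
  exact hx.inv.sub_intCast _

theorem irrational_iterate_gaussMap {x : ℝ} (hx : Irrational x) (n : ℕ) :
    Irrational (gaussMap^[n] x) := by
  induction n with
  | zero => exact hx
  | succ n ih => rw [Function.iterate_succ_apply']; exact irrational_gaussMap ih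

theorem iterate_gaussMap_mem_Ioo {x : ℝ} (hx : Irrational x) (h : x ∈ Ico (0 : ℝ) 1) (n : ℕ) :
    gaussMap^[n] x ∈ Ioo (0 : ℝ) 1 := by
  have key : gaussMap^[n] x ∈ Ico (0 : ℝ) 1 := by
    cases n with
    | zero => exact h
    | succ n =>
      rw [Function.iterate_succ_apply']
      exact ⟨Int.fract_nonneg _, Int.fract_lt_one _⟩
  exact ⟨lt_of_le_of_ne key.1 (irrational_iterate_gaussMap hx n).ne_zero.symm, key.2⟩

theorem one_div_iterate_gaussMap (n : ℕ) (x : ℝ) :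
    1 / gaussMap^[n] x = partialQuotient (n + 1) x + gaussMap^[n + 1] x := by
  rw [partialQuotient_succ, Function.iterate_succ_apply', gaussMap, Int.floor_add_fract]

theorem one_le_partialQuotient {x : ℝ} (hx : Irrational x) (h : x ∈ Ico (0 : ℝ) 1) (n : ℕ) :
    1 ≤ partialQuotient (n + 1) x := by
  obtain ⟨h0, h1⟩ := iterate_gaussMap_mem_Ioo hx h n
  rw [partialQuotient_succ, Int.le_floor, Int.cast_one, le_div_iff₀ h0]
  linarith

theorem one_le_partialQuotient_cast {x : ℝ} (hx : Irrational x) (h : x ∈ Ico (0 : ℝ) 1) {n : ℕ}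
    (hn : 1 ≤ n) : (1 : ℝ) ≤ partialQuotient n x := by
  obtain ⟨k, rfl⟩ := Nat.exists_eq_add_of_le' hn
  exact_mod_cast one_le_partialQuotient hx h k

/-- On a cylinder of order `n` the iterate `T^n` is a Möbius map; this is its exact distortion. -/
theorem abs_sub_eq_of_partialQuotient_eq {x y : ℝ} {n : ℕ}
    (hx : ∀ j < n, gaussMap^[j] x ≠ 0) (hy : ∀ j < n, gaussMap^[j] y ≠ 0)
    (hxy : ∀ j < n, partialQuotient (j + 1) x = partialQuotient (j + 1) y) :
    |x - y| = |gaussMap^[n] x - gaussMap^[n] y| *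
      ∏ j ∈ Finset.range n, |gaussMap^[j] x * gaussMap^[j] y| := by
  induction n with
  | zero => simp
  | succ n ih =>
    rw [ih (fun j hj => hx j (by omega)) (fun j hj => hy j (by omega))
      (fun j hj => hxy j (by omega)), Finset.prod_range_succ]
    have ex := one_div_iterate_gaussMap n x
    have ey := one_div_iterate_gaussMap n y
    rw [hxy n (by omega)] at ex
    have hx' := hx n (by omega)
    have hy' := hy n (by omega)
    have : gaussMap^[n] x - gaussMap^[n] y = -(gaussMap^[n + 1] x - gaussMap^[n + 1] y) *
        (gaussMap^[n] x * gaussMap^[n] y) := by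
      have e : gaussMap^[n + 1] x - gaussMap^[n + 1] y
          = 1 / gaussMap^[n] x - 1 / gaussMap^[n] y := by rw [ex, ey]; ring
      rw [e]; field_simp; ring
    rw [this, abs_mul, abs_neg]
    ring

/-! ### Numbers with prescribed digits -/

/-- The Gauss orbit of a rational number ends in `0`: the numerators decrease along it. -/
theorem exists_iterate_gaussMap_eq_zero (p : ℕ) :
    ∀ q : ℕ, p < q → ∃ n, gaussMap^[n] ((p : ℝ) / q) = 0 := by
  induction p using Nat.strong_induction_on with
  | _ p ih =>
    intro q hq
    rcases Nat.eq_zero_or_pos p with rfl | hp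
    · exact ⟨0, by simp⟩
    · obtain ⟨n, hn⟩ := ih (q % p) (Nat.mod_lt _ hp) p (Nat.mod_lt _ hp)
      refine ⟨n + 1, ?_⟩
      rw [Function.iterate_succ_apply, gaussMap, one_div_div,
        Int.fract_div_natCast_eq_div_natCast_mod, hn]

theorem irrational_of_iterate_gaussMap_ne_zero {x : ℝ} (h : x ∈ Ico (0 : ℝ) 1)
    (hx : ∀ n, gaussMap^[n] x ≠ 0) : Irrational x := by
  rintro ⟨r, rfl⟩
  have h0 : 0 ≤ r := by exact_mod_cast h.1
  have h1 : r < 1 := by exact_mod_cast h.2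
  have e : (r : ℝ) = (r.num.natAbs : ℝ) / (r.den : ℝ) := by
    rw [Nat.cast_natAbs, abs_of_nonneg (Rat.num_nonneg.2 h0)]
    exact_mod_cast (Rat.num_div_den r).symm
  have hlt : r.num.natAbs < r.den := by
    have := Rat.num_lt_denom_iff.2 h1
    have := Rat.num_nonneg.2 h0
    omega
  obtain ⟨n, hn⟩ := exists_iterate_gaussMap_eq_zero _ _ hlt
  exact hx n (e ▸ hn)

/-- The finite continued fraction `[a 0, …, a (n - 1)]`. -/
noncomputable def cfConvergent : ℕ → (ℕ → ℕ) → ℝ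
  | 0, _ => 0
  | n + 1, a => 1 / (a 0 + cfConvergent n fun k => a (k + 1))

/-- The infinite continued fraction `[a 0, a 1, …]`. The value is used only for digits `≥ 2`,
for which convergence is immediate. -/
noncomputable def cfValue (a : ℕ → ℕ) : ℝ := limUnder atTop fun n => cfConvergent n a

theorem cfConvergent_mem {a : ℕ → ℕ} (ha : ∀ k, 2 ≤ a k) (n : ℕ) :
    cfConvergent n a ∈ Icc (0 : ℝ) (1 / 2) := by
  induction n generalizing a with
  | zero => constructor <;> simp [cfConvergent]
  | succ n ih =>
    have h := ih (a := fun k => a (k + 1)) fun k => ha _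
    have h2 : (2 : ℝ) ≤ a 0 := by exact_mod_cast ha 0
    refine ⟨div_nonneg zero_le_one (by linarith [h.1]), ?_⟩
    exact one_div_le_one_div_of_le (by norm_num) (by linarith [h.1])

theorem dist_cfConvergent_succ {a : ℕ → ℕ} (ha : ∀ k, 2 ≤ a k) (n : ℕ) :
    dist (cfConvergent n a) (cfConvergent (n + 1) a) ≤ 1 * (1 / 4) ^ n := by
  induction n generalizing a with
  | zero =>
    have h0 := cfConvergent_mem ha 0
    have h1 := cfConvergent_mem ha 1
    rw [Real.dist_eq, abs_le]
    constructor <;> norm_num <;> linarith [h0.1, h0.2, h1.1, h1.2]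
  | succ n ih =>
    have h := ih (a := fun k => a (k + 1)) fun k => ha _
    have h2 : (2 : ℝ) ≤ a 0 := by exact_mod_cast ha 0
    have m0 := (cfConvergent_mem (a := fun k => a (k + 1)) (fun k => ha _) n).1
    have m1 := (cfConvergent_mem (a := fun k => a (k + 1)) (fun k => ha _) (n + 1)).1
    rw [cfConvergent, cfConvergent.eq_2 _ (n + 1)]
    set s := cfConvergent n fun k => a (k + 1)
    set r := cfConvergent (n + 1) fun k => a (k + 1)
    have e : 1 / (a 0 + s) - 1 / (a 0 + r) = (r - s) / ((a 0 + s) * (a 0 + r)) := by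
      have : (a 0 : ℝ) + s ≠ 0 := by positivity
      have : (a 0 : ℝ) + r ≠ 0 := by positivity
      field_simp; ring
    have hd : (4 : ℝ) ≤ (a 0 + s) * (a 0 + r) := by nlinarith
    rw [Real.dist_eq, e, abs_div, abs_of_pos (a := (a 0 + s) * (a 0 + r)) (by linarith),
      abs_sub_comm, ← Real.dist_eq, pow_succ, div_le_iff₀ (by linarith)]
    calc dist s r ≤ 1 * (1 / 4) ^ n := h
      _ = 1 * ((1 / 4) ^ n * (1 / 4)) * 4 := by ring
      _ ≤ _ := by gcongr

theorem tendsto_cfConvergent {a : ℕ → ℕ} (ha : ∀ k, 2 ≤ a k) :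
    Tendsto (fun n => cfConvergent n a) atTop (nhds (cfValue a)) :=
  (cauchySeq_of_le_geometric _ _ (by norm_num) (dist_cfConvergent_succ ha)).tendsto_limUnder

theorem cfValue_mem_Icc {a : ℕ → ℕ} (ha : ∀ k, 2 ≤ a k) : cfValue a ∈ Icc (0 : ℝ) (1 / 2) :=
  isClosed_Icc.mem_of_tendsto (tendsto_cfConvergent ha) (.of_forall (cfConvergent_mem ha))

theorem cfValue_eq {a : ℕ → ℕ} (ha : ∀ k, 2 ≤ a k) :
    cfValue a = 1 / (a 0 + cfValue fun k => a (k + 1)) := by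
  have h2 : (2 : ℝ) ≤ a 0 := by exact_mod_cast ha 0
  have hs : ∀ k, 2 ≤ (fun k => a (k + 1)) k := fun k => ha _
  refine tendsto_nhds_unique ((tendsto_add_atTop_iff_nat 1).2 (tendsto_cfConvergent ha)) ?_
  exact tendsto_const_nhds.div (tendsto_const_nhds.add (tendsto_cfConvergent hs))
    (by linarith [(cfValue_mem_Icc hs).1])

theorem cfValue_pos {a : ℕ → ℕ} (ha : ∀ k, 2 ≤ a k) : 0 < cfValue a := by
  have h2 : (2 : ℝ) ≤ a 0 := by exact_mod_cast ha 0
  rw [cfValue_eq ha]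
  exact one_div_pos.2 (by linarith [(cfValue_mem_Icc fun k => ha (k + 1)).1])

theorem one_div_cfValue {a : ℕ → ℕ} (ha : ∀ k, 2 ≤ a k) :
    1 / cfValue a = a 0 + cfValue fun k => a (k + 1) := by
  rw [cfValue_eq ha, one_div_one_div]

theorem gaussMap_cfValue {a : ℕ → ℕ} (ha : ∀ k, 2 ≤ a k) :
    gaussMap (cfValue a) = cfValue fun k => a (k + 1) := by
  have h := cfValue_mem_Icc fun k => ha (k + 1)
  rw [gaussMap, one_div_cfValue ha, Int.fract_natCast_add, Int.fract_eq_self]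
  exact ⟨h.1, by linarith [h.2]⟩

theorem iterate_gaussMap_cfValue {a : ℕ → ℕ} (ha : ∀ k, 2 ≤ a k) (n : ℕ) :
    gaussMap^[n] (cfValue a) = cfValue fun k => a (k + n) := by
  induction n with
  | zero => rfl
  | succ n ih =>
    rw [Function.iterate_succ_apply', ih, gaussMap_cfValue fun k => ha _]
    congr 1; ext k; congr 1; omega

theorem irrational_cfValue {a : ℕ → ℕ} (ha : ∀ k, 2 ≤ a k) : Irrational (cfValue a) := by
  have h := cfValue_mem_Icc ha
  refine irrational_of_iterate_gaussMap_ne_zero ⟨h.1, by linarith [h.2]⟩ fun n => ?_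
  rw [iterate_gaussMap_cfValue ha]
  exact (cfValue_pos fun k => ha _).ne'

theorem partialQuotient_cfValue {a : ℕ → ℕ} (ha : ∀ k, 2 ≤ a k) (n : ℕ) :
    partialQuotient (n + 1) (cfValue a) = a n := by
  have h := cfValue_mem_Icc fun k => ha (k + 1 + n)
  rw [partialQuotient_succ, iterate_gaussMap_cfValue ha, one_div_cfValue fun k => ha _,
    Int.floor_natCast_add, zero_add, Int.floor_eq_zero_iff.2 ⟨h.1, by linarith [h.2]⟩, add_zero]

/-! ### Covering sets with large partial quotients -/

theorem tsum_prod_fin_eq_pow (f : ℕ → ENNReal) (p : ℕ) :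
    ∑' a : Fin p → ℕ, ∏ j, f (a j) = (∑' k, f k) ^ p := by
  induction p with
  | zero => simp
  | succ p ih =>
    rw [← (Fin.consEquiv fun _ : Fin (p + 1) => ℕ).tsum_eq, ENNReal.tsum_prod', pow_succ',
      ← ENNReal.tsum_mul_right]
    refine tsum_congr fun k => ?_
    rw [← ih, ← ENNReal.tsum_mul_left]
    refine tsum_congr fun a => ?_
    simp [Fin.consEquiv, Fin.prod_univ_succ]

/-- The irrational numbers whose first `p` partial quotients are `a`, and whose next one is at least
the power `c - 1` of the product of `a`. -/
def largeDigitCylinder (c : ℝ) (p : ℕ) (a : Fin p → ℕ) : Set ℝ :=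
  {x | x ∈ Ico (0 : ℝ) 1 ∧ Irrational x ∧ (∀ j : Fin p, partialQuotient (j + 1) x = a j) ∧
    (∏ j, (a j : ℝ)) ^ (c - 1) ≤ partialQuotient (p + 1) x}

theorem ediam_largeDigitCylinder_le (c : ℝ) (p : ℕ) (a : Fin p → ℕ) :
    Metric.ediam (largeDigitCylinder c p a) ≤ ENNReal.ofReal ((∏ j, (a j : ℝ)) ^ (-(1 + c))) := by
  refine Metric.ediam_le fun x hx y hy => ?_
  obtain ⟨hx01, hxi, hxa, hxp⟩ := hx
  obtain ⟨hy01, hyi, hya, hyp⟩ := hy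
  rw [edist_dist, Real.dist_eq]
  refine ENNReal.ofReal_le_ofReal ?_
  have ha : ∀ j, (1 : ℝ) ≤ a j := fun j => by
    have := one_le_partialQuotient hxi hx01 j
    rw [hxa j] at this
    exact_mod_cast this
  set Q : ℝ := ∏ j, (a j : ℝ) with hQ
  have hQ0 : 0 < Q := Finset.prod_pos fun j _ => lt_of_lt_of_le one_pos (ha j)
  have bound : ∀ {z : ℝ}, Irrational z → z ∈ Ico (0 : ℝ) 1 → ∀ n : ℕ, ∀ A : ℝ, 0 < A →
      A ≤ partialQuotient (n + 1) z → gaussMap^[n] z ∈ Ioc 0 A⁻¹ := by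
    intro z hz hz01 n A hA hAz
    have hpos := (iterate_gaussMap_mem_Ioo hz hz01 n).1
    refine ⟨hpos, ?_⟩
    have e := one_div_iterate_gaussMap n z
    have := (iterate_gaussMap_mem_Ioo hz hz01 (n + 1)).1
    rw [le_inv_comm₀ hpos hA, ← one_div, e]
    linarith
  rw [abs_sub_eq_of_partialQuotient_eq (n := p)
    (fun j _ => (iterate_gaussMap_mem_Ioo hxi hx01 j).1.ne')
    (fun j _ => (iterate_gaussMap_mem_Ioo hyi hy01 j).1.ne')
    (fun j hj => (hxa ⟨j, hj⟩).trans (hya ⟨j, hj⟩).symm)]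
  have hA : 0 < Q ^ (c - 1) := Real.rpow_pos_of_pos hQ0 _
  have h1 : |gaussMap^[p] x - gaussMap^[p] y| ≤ (Q ^ (c - 1))⁻¹ := by
    have bx := bound hxi hx01 p _ hA hxp
    have bY := bound hyi hy01 p _ hA hyp
    rw [abs_le]; constructor <;> linarith [bx.1, bx.2, bY.1, bY.2]
  have h2 : ∏ j ∈ Finset.range p, |gaussMap^[j] x * gaussMap^[j] y| ≤ (Q ^ (2 : ℝ))⁻¹ := by
    rw [← Fin.prod_univ_eq_prod_range (fun j => |gaussMap^[j] x * gaussMap^[j] y|) p, hQ,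
      Real.rpow_two, ← Finset.prod_pow, ← Finset.prod_inv_distrib]
    refine Finset.prod_le_prod (fun _ _ => abs_nonneg _) fun j _ => ?_
    have hj : (0 : ℝ) < a j := lt_of_lt_of_le one_pos (ha j)
    have bx := bound hxi hx01 j _ hj (by rw [hxa j]; simp)
    have bY := bound hyi hy01 j _ hj (by rw [hya j]; simp)
    rw [abs_of_pos (mul_pos bx.1 bY.1), sq, mul_inv]
    exact mul_le_mul bx.2 bY.2 bY.1.le (inv_nonneg.2 hj.le)
  calc _ ≤ (Q ^ (c - 1))⁻¹ * (Q ^ (2 : ℝ))⁻¹ :=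
        mul_le_mul h1 h2 (Finset.prod_nonneg fun _ _ => abs_nonneg _) (inv_nonneg.2 hA.le)
    _ = Q ^ (-(1 + c)) := by
        rw [← mul_inv, ← Real.rpow_add hQ0, ← Real.rpow_neg hQ0.le]
        congr 1; ring

/-- If for every point of `S` the products `a_1 ⋯ a_p` grow faster than exponentially, and
infinitely often `a_{p+1} ≥ (a_1 ⋯ a_p) ^ (c - 1)`, then `dim S ≤ 1 / (1 + c)`. -/
theorem dimH_le_of_frequently_large {S : Set ℝ} {c : ℝ} (hc : 0 ≤ c)
    (h01 : ∀ x ∈ S, x ∈ Ico (0 : ℝ) 1) (hirr : ∀ x ∈ S, Irrational x)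
    (hgrow : ∀ x ∈ S, ∀ K : ℝ, ∀ᶠ p : ℕ in atTop,
      Real.exp (K * p) ≤ ∏ j ∈ Finset.range p, (partialQuotient (j + 1) x : ℝ))
    (hfreq : ∀ x ∈ S, ∃ᶠ p : ℕ in atTop,
      (∏ j ∈ Finset.range p, (partialQuotient (j + 1) x : ℝ)) ^ (c - 1)
        ≤ partialQuotient (p + 1) x) :
    dimH S ≤ ENNReal.ofReal (1 / (1 + c)) := by
  refine le_of_forall_gt_imp_ge_of_dense fun e he => ?_
  obtain ⟨d, hd, hde⟩ := ENNReal.lt_iff_exists_nnreal_btwn.1 he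
  refine le_trans ?_ hde.le
  have hcd : 1 < (1 + c) * d := by
    have : 1 / (1 + c) < (d : ℝ) := by
      rwa [← ENNReal.ofReal_coe_nnreal, ENNReal.ofReal_lt_ofReal_iff_of_nonneg (by positivity)] at hd
    rw [div_lt_iff₀ (by positivity)] at this
    linarith
  have hd0 : (0 : ℝ) < d := by
    by_contra h
    have : (d : ℝ) = 0 := le_antisymm (not_lt.1 h) d.2
    rw [this] at hcd; linarith
  -- Split the exponent `(1 + c) d` as `σ + δ` with `σ > 1`: the part `σ` makes the sum over the
  -- digits converge, the part `δ` gains a large exponential factor.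
  set σ : ℝ := (1 + (1 + c) * d) / 2 with hσ
  set δ : ℝ := ((1 + c) * d - 1) / 2 with hδ
  have hσ1 : 1 < σ := by rw [hσ]; linarith
  have hδ0 : 0 < δ := by rw [hδ]; linarith
  set Z : ENNReal := ∑' k : ℕ, ENNReal.ofReal ((k : ℝ) ^ (-σ)) with hZ
  have hZtop : Z ≠ ⊤ := by
    have hs : Summable fun k : ℕ => (k : ℝ) ^ (-σ) := Real.summable_nat_rpow.2 (by linarith)
    rw [hZ, ← ENNReal.ofReal_tsum_of_nonneg (fun k => by positivity) hs]
    exact ENNReal.ofReal_ne_top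
  obtain ⟨K, hK1, hKZ⟩ : ∃ K : ℝ, 1 ≤ K ∧ ENNReal.ofReal (Real.exp (-(δ * K))) * Z ≤ 2⁻¹ := by
    obtain ⟨z, hz, hzZ⟩ : ∃ z : ℝ, 0 ≤ z ∧ Z = ENNReal.ofReal z :=
      ⟨Z.toReal, ENNReal.toReal_nonneg, (ENNReal.ofReal_toReal hZtop).symm⟩
    refine ⟨max 1 (Real.log (2 * z + 1) / δ), le_max_left _ _, ?_⟩
    have h1 : Real.log (2 * z + 1) ≤ δ * max 1 (Real.log (2 * z + 1) / δ) := by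
      rw [← div_le_iff₀' hδ0]; exact le_max_right _ _
    have h2 : 2 * z + 1 ≤ Real.exp (δ * max 1 (Real.log (2 * z + 1) / δ)) := by
      rw [← Real.log_le_iff_le_exp (by linarith)]; exact h1
    rw [hzZ]
    rw [← ENNReal.ofReal_mul (Real.exp_pos _).le, Real.exp_neg]
    rw [show (2 : ENNReal)⁻¹ = ENNReal.ofReal 2⁻¹ by
      rw [ENNReal.ofReal_inv_of_pos two_pos, ENNReal.ofReal_ofNat]]
    refine ENNReal.ofReal_le_ofReal ?_
    rw [inv_mul_le_iff₀ (Real.exp_pos _)]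
    linarith
  let t : (N : ℕ) → (Σ p : ℕ, (Fin p → ℕ)) → Set ℝ := fun N i =>
    {x | x ∈ largeDigitCylinder c i.1 i.2 ∧ N ≤ i.1 ∧ Real.exp (K * i.1) ≤ ∏ j, (i.2 j : ℝ)}
  have hdiam : ∀ N i, (t N i).Nonempty → N ≤ i.1 ∧ Real.exp (K * i.1) ≤ ∏ j, (i.2 j : ℝ) :=
    fun N i ⟨x, hx⟩ => hx.2
  have hle : ∀ N i, Metric.ediam (t N i) ≤ ENNReal.ofReal ((∏ j, (i.2 j : ℝ)) ^ (-(1 + c))) :=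
    fun N i => (Metric.ediam_mono fun x hx => hx.1).trans (ediam_largeDigitCylinder_le c i.1 i.2)
  refine dimH_le_of_hausdorffMeasure_ne_top (ne_top_of_le_ne_top ENNReal.ofNat_ne_top
    (b := 2) ((MeasureTheory.Measure.hausdorffMeasure_le_liminf_tsum (d : ℝ) S (l := atTop)
      (fun N : ℕ => ENNReal.ofReal (Real.exp (-N))) ?_ t (.of_forall fun N i => ?_)
      (.of_forall fun N x hx => ?_)).trans ?_))
  · rw [← ENNReal.ofReal_zero]
    exact ENNReal.tendsto_ofReal (Real.tendsto_exp_neg_atTop_nhds_zero.comp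
      tendsto_natCast_atTop_atTop)
  · rcases (t N i).eq_empty_or_nonempty with h | h
    · rw [h, Metric.ediam_empty]; exact zero_le
    obtain ⟨hN, hQ⟩ := hdiam N i h
    refine (hle N i).trans (ENNReal.ofReal_le_ofReal ?_)
    have hNp : (N : ℝ) ≤ i.1 := by exact_mod_cast hN
    have h1 : Real.exp N ≤ ∏ j, (i.2 j : ℝ) := (Real.exp_le_exp.2 (by nlinarith)).trans hQ
    have h2 : (1 : ℝ) ≤ ∏ j, (i.2 j : ℝ) :=
      (Real.one_le_exp (Nat.cast_nonneg N)).trans h1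
    calc (∏ j, (i.2 j : ℝ)) ^ (-(1 + c)) ≤ (∏ j, (i.2 j : ℝ)) ^ (-1 : ℝ) :=
          Real.rpow_le_rpow_of_exponent_le h2 (by linarith)
      _ = (∏ j, (i.2 j : ℝ))⁻¹ := Real.rpow_neg_one _
      _ ≤ (Real.exp N)⁻¹ := inv_anti₀ (Real.exp_pos _) h1
      _ = Real.exp (-N) := (Real.exp_neg _).symm
  · obtain ⟨p, hp1, hp2, hp3⟩ :=
      ((hfreq x hx).and_eventually ((hgrow x hx K).and (eventually_ge_atTop N))).exists
    have hcast : ∀ j, (((partialQuotient (j + 1) x).toNat : ℕ) : ℤ) = partialQuotient (j + 1) x :=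
      fun j => Int.toNat_of_nonneg (zero_le_one.trans (one_le_partialQuotient (hirr x hx)
        (h01 x hx) j))
    have hprod : ∏ j : Fin p, (((partialQuotient (j + 1) x).toNat : ℕ) : ℝ)
        = ∏ j ∈ Finset.range p, (partialQuotient (j + 1) x : ℝ) := by
      rw [← Fin.prod_univ_eq_prod_range (fun j => (partialQuotient (j + 1) x : ℝ)) p]
      exact Finset.prod_congr rfl fun j _ => by exact_mod_cast congrArg (Int.cast (R := ℝ)) (hcast j)
    refine mem_iUnion.2 ⟨⟨p, fun j => (partialQuotient (j + 1) x).toNat⟩,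
      ⟨h01 x hx, hirr x hx, fun j => (hcast j).symm, ?_⟩, hp3, ?_⟩
    · simpa only [hprod] using hp1
    · simpa only [hprod] using hp2
  · refine (liminf_le_liminf (v := fun _ => (2 : ENNReal)) (.of_forall fun N => ?_)).trans
      (by simp)
    have hterm : ∀ i : Σ p : ℕ, (Fin p → ℕ), Metric.ediam (t N i) ^ (d : ℝ) ≤
        ENNReal.ofReal (Real.exp (-(δ * K))) ^ i.1 *
          ∏ j, ENNReal.ofReal ((i.2 j : ℝ) ^ (-σ)) := by
      intro i
      rcases (t N i).eq_empty_or_nonempty with h | h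
      · rw [h, Metric.ediam_empty, ENNReal.zero_rpow_of_pos hd0]; exact zero_le
      obtain ⟨-, hQ⟩ := hdiam N i h
      have hQ0 := (Real.exp_pos _).trans_le hQ
      refine (ENNReal.rpow_le_rpow (hle N i) hd0.le).trans ?_
      rw [ENNReal.ofReal_rpow_of_pos (Real.rpow_pos_of_pos hQ0 _), ← Real.rpow_mul hQ0.le,
        ← ENNReal.ofReal_prod_of_nonneg (fun j _ => by positivity),
        ← ENNReal.ofReal_pow (Real.exp_pos _).le, ← ENNReal.ofReal_mul (by positivity)]
      refine ENNReal.ofReal_le_ofReal ?_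
      rw [Real.finsetProd_rpow _ _ fun j _ => Nat.cast_nonneg _,
        show -(1 + c) * (d : ℝ) = -δ + -σ by rw [hσ, hδ]; ring, Real.rpow_add hQ0]
      gcongr
      rw [← Real.exp_nat_mul, Real.rpow_neg hQ0.le,
        show (i.1 : ℝ) * -(δ * K) = -((K * i.1) * δ) by ring, Real.exp_neg, Real.exp_mul]
      exact inv_anti₀ (by positivity) (Real.rpow_le_rpow (Real.exp_pos _).le hQ hδ0.le)
    calc ∑' i, Metric.ediam (t N i) ^ (d : ℝ)
        ≤ ∑' i : Σ p : ℕ, (Fin p → ℕ), ENNReal.ofReal (Real.exp (-(δ * K))) ^ i.1 *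
          ∏ j, ENNReal.ofReal ((i.2 j : ℝ) ^ (-σ)) := ENNReal.tsum_le_tsum hterm
      _ = ∑' p : ℕ, (ENNReal.ofReal (Real.exp (-(δ * K))) * Z) ^ p := by
          rw [ENNReal.tsum_sigma']
          refine tsum_congr fun p => ?_
          dsimp only
          rw [ENNReal.tsum_mul_left, mul_pow, hZ, ← tsum_prod_fin_eq_pow]
      _ ≤ ∑' p : ℕ, (2⁻¹ : ENNReal) ^ p := ENNReal.tsum_le_tsum fun p => by gcongr
      _ = 2 := by rw [ENNReal.tsum_geometric, ENNReal.one_sub_inv_two, inv_inv]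

/-! ### A Cantor set of prescribed digit sizes -/

theorem inv_le_iterate_gaussMap_cfValue {a u : ℕ → ℕ} (ha : ∀ k, 2 ≤ a k)
    (hau : ∀ k, a k < 2 * u k) (n : ℕ) :
    (2 * (u n : ℝ))⁻¹ ≤ gaussMap^[n] (cfValue a) := by
  rw [iterate_gaussMap_cfValue ha, cfValue_eq fun k => ha _, one_div, zero_add]
  have h := cfValue_mem_Icc fun k => ha (k + 1 + n)
  have h1 : (a n : ℝ) + 1 ≤ 2 * u n := by exact_mod_cast hau n
  have h2 : (2 : ℝ) ≤ a n := by exact_mod_cast ha n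
  exact inv_anti₀ (by linarith [h.1]) (by linarith [h.2])

/-- Two continued fractions with digits `≥ 2` of sizes comparable to `u`, which first differ at the
digit `n`, are separated in terms of `u` and the difference of these digits. -/
theorem le_abs_cfValue_sub {a a' u : ℕ → ℕ} (ha : ∀ k, 2 ≤ a k) (ha' : ∀ k, 2 ≤ a' k)
    (hau : ∀ k, a k < 2 * u k) (hau' : ∀ k, a' k < 2 * u k) {n : ℕ}
    (hn : ∀ j < n, a j = a' j) (hne : a n ≠ a' n) :
    |(a n : ℝ) - a' n| / (8 * (u n : ℝ) ^ 2 * (4 ^ n * (∏ j ∈ Finset.range n, (u j : ℝ)) ^ 2))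
      ≤ |cfValue a - cfValue a'| := by
  have hu : ∀ j, (0 : ℝ) < u j := fun j => by
    have := hau j
    exact_mod_cast (by omega : 0 < u j)
  have hpos : ∀ j, 0 < gaussMap^[j] (cfValue a) := fun j => by
    rw [iterate_gaussMap_cfValue ha]; exact cfValue_pos fun k => ha _
  have hpos' : ∀ j, 0 < gaussMap^[j] (cfValue a') := fun j => by
    rw [iterate_gaussMap_cfValue ha']; exact cfValue_pos fun k => ha' _
  have hlow : ∀ j, ((2 * (u j : ℝ)) ^ 2)⁻¹
      ≤ gaussMap^[j] (cfValue a) * gaussMap^[j] (cfValue a') := fun j => by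
    rw [sq, mul_inv]
    have := hu j
    exact mul_le_mul (inv_le_iterate_gaussMap_cfValue ha hau j)
      (inv_le_iterate_gaussMap_cfValue ha' hau' j) (by positivity) (hpos j).le
  have htail : |(a n : ℝ) - a' n| / 2 ≤
      |1 / gaussMap^[n] (cfValue a) - 1 / gaussMap^[n] (cfValue a')| := by
    have h := cfValue_mem_Icc fun k => ha (k + 1 + n)
    have h' := cfValue_mem_Icc fun k => ha' (k + 1 + n)
    rw [iterate_gaussMap_cfValue ha, iterate_gaussMap_cfValue ha', one_div_cfValue fun k => ha _,
      one_div_cfValue fun k => ha' _, zero_add]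
    set z := cfValue fun k => a (k + 1 + n)
    set z' := cfValue fun k => a' (k + 1 + n)
    have h1 : (1 : ℝ) ≤ |(a n : ℝ) - a' n| := by
      have : (1 : ℤ) ≤ |(a n : ℤ) - a' n| := Int.one_le_abs (by omega)
      exact_mod_cast this
    have h2 : |z' - z| ≤ 1 / 2 := by rw [abs_le]; constructor <;> linarith [h.1, h.2, h'.1, h'.2]
    have h3 : |(a n : ℝ) - a' n| ≤ |a n + z - (a' n + z')| + |z' - z| := by
      have := abs_add_le (a n + z - (a' n + z')) (z' - z)
      rwa [show (a n : ℝ) + z - (a' n + z') + (z' - z) = a n - a' n by ring] at this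
    linarith
  rw [abs_sub_eq_of_partialQuotient_eq (n := n) (fun j _ => (hpos j).ne')
    (fun j _ => (hpos' j).ne') (fun j hj => by
      rw [partialQuotient_cfValue ha, partialQuotient_cfValue ha', hn j hj])]
  have e : |gaussMap^[n] (cfValue a) - gaussMap^[n] (cfValue a')| =
      |1 / gaussMap^[n] (cfValue a) - 1 / gaussMap^[n] (cfValue a')| *
        (gaussMap^[n] (cfValue a) * gaussMap^[n] (cfValue a')) := by
    rw [abs_sub_comm, ← abs_of_pos (mul_pos (hpos n) (hpos' n)), ← abs_mul]
    have := (hpos n).ne'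
    have := (hpos' n).ne'
    congr 1; field_simp
  have hprod : (∏ j ∈ Finset.range n, (2 * (u j : ℝ)) ^ 2)⁻¹ ≤
      ∏ j ∈ Finset.range n, |gaussMap^[j] (cfValue a) * gaussMap^[j] (cfValue a')| := by
    rw [← Finset.prod_inv_distrib]
    exact Finset.prod_le_prod (fun j _ => by positivity) fun j _ =>
      (hlow j).trans (le_abs_self _)
  calc _ = |(a n : ℝ) - a' n| / 2 * ((2 * (u n : ℝ)) ^ 2)⁻¹ *
        (∏ j ∈ Finset.range n, (2 * (u j : ℝ)) ^ 2)⁻¹ := by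
        have h4 : (4 : ℝ) ^ n = (2 ^ n) ^ 2 := by
          rw [← pow_mul, mul_comm, pow_mul]; norm_num
        rw [Finset.prod_pow, Finset.prod_mul_distrib, Finset.prod_const, Finset.card_range, h4]
        ring
    _ ≤ _ := by
        rw [e]
        exact mul_le_mul (mul_le_mul htail (hlow n) (by positivity) (abs_nonneg _)) hprod
          (inv_nonneg.2 (Finset.prod_nonneg fun j _ => sq_nonneg _))
          (mul_nonneg (abs_nonneg _) (mul_pos (hpos n) (hpos' n)).le)

/-- The `n`-th remainder in the expansion of `y ∈ [0, 1)` with respect to the mixed radix `u`. -/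
noncomputable def radixRemainder (u : ℕ → ℕ) : ℕ → ℝ → ℝ
  | 0, y => y
  | n + 1, y => Int.fract (u n * radixRemainder u n y)

/-- The `n`-th digit, in `{0, …, u n - 1}`, of `y ∈ [0, 1)` with respect to the mixed radix `u`. -/
noncomputable def radixDigit (u : ℕ → ℕ) (n : ℕ) (y : ℝ) : ℕ := ⌊u n * radixRemainder u n y⌋₊

theorem radixRemainder_mem (u : ℕ → ℕ) {y : ℝ} (hy : y ∈ Ico (0 : ℝ) 1) (n : ℕ) :
    radixRemainder u n y ∈ Ico (0 : ℝ) 1 := by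
  cases n with
  | zero => exact hy
  | succ n => exact ⟨Int.fract_nonneg _, Int.fract_lt_one _⟩

theorem mul_radixRemainder (u : ℕ → ℕ) {y : ℝ} (hy : y ∈ Ico (0 : ℝ) 1) (n : ℕ) :
    u n * radixRemainder u n y = radixDigit u n y + radixRemainder u (n + 1) y := by
  have h := mul_nonneg (Nat.cast_nonneg (u n)) (radixRemainder_mem u hy n).1
  rw [radixDigit, natCast_floor_eq_intCast_floor h, radixRemainder, Int.floor_add_fract]

theorem radixDigit_lt {u : ℕ → ℕ} (hu : ∀ n, 0 < u n) {y : ℝ} (hy : y ∈ Ico (0 : ℝ) 1) (n : ℕ) :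
    radixDigit u n y < u n := by
  have h := radixRemainder_mem u hy n
  have hn : (0 : ℝ) < u n := by exact_mod_cast hu n
  rw [radixDigit, Nat.floor_lt (mul_nonneg hn.le h.1)]
  nlinarith [h.2]

theorem sub_eq_of_radixDigit_eq {u : ℕ → ℕ} (hu : ∀ n, 0 < u n) {y y' : ℝ}
    (hy : y ∈ Ico (0 : ℝ) 1) (hy' : y' ∈ Ico (0 : ℝ) 1) {n : ℕ}
    (h : ∀ j < n, radixDigit u j y = radixDigit u j y') :
    y - y' = (radixRemainder u n y - radixRemainder u n y') / ∏ j ∈ Finset.range n, (u j : ℝ) := by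
  induction n with
  | zero => simp [radixRemainder]
  | succ n ih =>
    have hn : (u n : ℝ) ≠ 0 := by exact_mod_cast (hu n).ne'
    have hp : ∏ j ∈ Finset.range n, (u j : ℝ) ≠ 0 :=
      Finset.prod_ne_zero_iff.2 fun j _ => by exact_mod_cast (hu j).ne'
    have e := mul_radixRemainder u hy n
    have e' := mul_radixRemainder u hy' n
    rw [h n (by omega)] at e
    rw [ih fun j hj => h j (by omega), Finset.prod_range_succ, div_eq_div_iff hp (mul_ne_zero hp hn)]
    linear_combination (∏ j ∈ Finset.range n, (u j : ℝ)) * (e - e')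

theorem exists_radixDigit_ne {u : ℕ → ℕ} (hu : ∀ n, 2 ≤ u n) {y y' : ℝ}
    (hy : y ∈ Ico (0 : ℝ) 1) (hy' : y' ∈ Ico (0 : ℝ) 1) (hne : y ≠ y') :
    ∃ n, radixDigit u n y ≠ radixDigit u n y' := by
  by_contra! h
  have hle : ∀ n, |y - y'| ≤ (1 / 2) ^ n := fun n => by
    have hP : (2 : ℝ) ^ n ≤ ∏ j ∈ Finset.range n, (u j : ℝ) := by
      calc (2 : ℝ) ^ n = ∏ j ∈ Finset.range n, (2 : ℝ) := by simp
        _ ≤ _ := Finset.prod_le_prod (fun _ _ => by norm_num) fun j _ => by exact_mod_cast hu j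
    have hP0 : (0 : ℝ) < 2 ^ n := by positivity
    have m := radixRemainder_mem u hy n
    have m' := radixRemainder_mem u hy' n
    rw [sub_eq_of_radixDigit_eq (fun n => two_pos.trans_le (hu n)) hy hy' (n := n) fun j _ => h j,
      abs_div, abs_of_pos (hP0.trans_le hP), one_div, inv_pow, ← one_div]
    refine div_le_div₀ zero_le_one ?_ hP0 hP
    rw [abs_le]; constructor <;> linarith [m.1, m.2, m'.1, m'.2]
  have : |y - y'| ≤ 0 := ge_of_tendsto'
    (tendsto_pow_atTop_nhds_zero_of_lt_one (by norm_num : (0 : ℝ) ≤ 1 / 2) (by norm_num)) hle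
  exact hne (sub_eq_zero.1 (abs_eq_zero.1 (le_antisymm this (abs_nonneg _))))

/-- The number whose `n`-th partial quotient is `u n` plus the `n`-th mixed radix digit of `y`. -/
noncomputable def cantorPoint (u : ℕ → ℕ) (y : ℝ) : ℝ := cfValue fun n => u n + radixDigit u n y

/-- Distinct `y, y'` are closer together, and their images in the Cantor set farther apart, than two
bounds which depend only on the first position where their digits differ and on the difference
`d` there. -/
theorem exists_cantorPoint_separation {u : ℕ → ℕ} (hu : ∀ n, 2 ≤ u n) {y y' : ℝ}
    (hy : y ∈ Ico (0 : ℝ) 1) (hy' : y' ∈ Ico (0 : ℝ) 1) (hne : y ≠ y') :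
    ∃ (n : ℕ) (d : ℝ), 1 ≤ d ∧ d ≤ u n ∧
      |y - y'| ≤ 2 * d / (u n * ∏ j ∈ Finset.range n, (u j : ℝ)) ∧
      d / (8 * (u n : ℝ) ^ 2 * (4 ^ n * (∏ j ∈ Finset.range n, (u j : ℝ)) ^ 2))
        ≤ |cantorPoint u y - cantorPoint u y'| := by
  classical
  have hu0 : ∀ n, 0 < u n := fun n => two_pos.trans_le (hu n)
  have hex := exists_radixDigit_ne hu hy hy' hne
  have hfirst : ∀ j < Nat.find hex, radixDigit u j y = radixDigit u j y' := fun j hj =>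
    not_not.1 (Nat.find_min hex hj)
  have hd := Nat.find_spec hex
  set n := Nat.find hex
  have hun : (0 : ℝ) < u n := by exact_mod_cast hu0 n
  have hP : (0 : ℝ) < ∏ j ∈ Finset.range n, (u j : ℝ) :=
    Finset.prod_pos fun j _ => by exact_mod_cast hu0 j
  have hd1 : (1 : ℝ) ≤ |(radixDigit u n y : ℝ) - radixDigit u n y'| := by
    have : (1 : ℤ) ≤ |(radixDigit u n y : ℤ) - radixDigit u n y'| := Int.one_le_abs (by omega)
    exact_mod_cast this
  refine ⟨n, |(radixDigit u n y : ℝ) - radixDigit u n y'|, hd1, ?_, ?_, ?_⟩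
  · have h1 : (radixDigit u n y : ℝ) < u n := by exact_mod_cast radixDigit_lt hu0 hy n
    have h2 : (radixDigit u n y' : ℝ) < u n := by exact_mod_cast radixDigit_lt hu0 hy' n
    have h3 : (0 : ℝ) ≤ radixDigit u n y := Nat.cast_nonneg _
    have h4 : (0 : ℝ) ≤ radixDigit u n y' := Nat.cast_nonneg _
    rw [abs_le]; constructor <;> linarith
  · rw [sub_eq_of_radixDigit_eq hu0 hy hy' hfirst, abs_div, abs_of_pos hP, ← div_div]
    gcongr
    rw [le_div_iff₀ hun]
    have e := mul_radixRemainder u hy n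
    have e' := mul_radixRemainder u hy' n
    have m := radixRemainder_mem u hy (n + 1)
    have m' := radixRemainder_mem u hy' (n + 1)
    set D : ℝ := (radixDigit u n y : ℝ) - radixDigit u n y'
    rw [← abs_of_pos hun, ← abs_mul]
    have : (radixRemainder u n y - radixRemainder u n y') * u n =
        D + (radixRemainder u (n + 1) y - radixRemainder u (n + 1) y') := by
      simp only [D]; linear_combination e - e'
    rw [this]
    refine (abs_add_le _ _).trans ?_
    have : |radixRemainder u (n + 1) y - radixRemainder u (n + 1) y'| ≤ 1 := by
      rw [abs_le]; constructor <;> linarith [m.1, m.2, m'.1, m'.2]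
    linarith
  · have key := le_abs_cfValue_sub (a := fun n => u n + radixDigit u n y)
      (a' := fun n => u n + radixDigit u n y') (u := u) (n := n)
      (fun k => (hu k).trans (Nat.le_add_right _ _)) (fun k => (hu k).trans (Nat.le_add_right _ _))
      (fun k => by have := radixDigit_lt hu0 hy k; omega)
      (fun k => by have := radixDigit_lt hu0 hy' k; omega)
      (fun j hj => by rw [hfirst j hj]) (by omega)
    push_cast at key
    rwa [add_sub_add_left_eq_sub] at key

/-- The separation bounds of `exists_cantorPoint_separation` give Hölder continuity: the growth
condition on `u` absorbs the next digit, and `log (u n) → ∞` absorbs the factors `4 ^ n`. -/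
theorem exists_holder_constant {u : ℕ → ℕ} (hu : ∀ n, 2 ≤ u n) {b C₁ r : ℝ} (hr : 0 < r)
    (hrb : r * (1 + b) < 1) (hr1 : r ≤ 1)
    (hub : ∀ n, Real.log (u n) ≤ (b - 1) * ∑ j ∈ Finset.range n, Real.log (u j) + C₁)
    (hlim : Tendsto (fun n => Real.log (u n)) atTop atTop) :
    ∃ C : NNReal, ∀ (n : ℕ) (d : ℝ), 1 ≤ d → d ≤ u n →
      2 * d / (u n * ∏ j ∈ Finset.range n, (u j : ℝ)) ≤ C *
        (d / (8 * (u n : ℝ) ^ 2 * (4 ^ n * (∏ j ∈ Finset.range n, (u j : ℝ)) ^ 2))) ^ r := by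
  have hu0 : ∀ n, (0 : ℝ) < u n := fun n => by exact_mod_cast two_pos.trans_le (hu n)
  have hlog0 : ∀ n, 0 ≤ Real.log (u n) := fun n => Real.log_natCast_nonneg _
  set V : ℕ → ℝ := fun n => ∑ j ∈ Finset.range n, Real.log (u j) with hV
  set δ : ℝ := 1 - r * (1 + b) with hδ
  have hδ0 : 0 < δ := by rw [hδ]; linarith
  -- The sum `V` is eventually larger than any linear function.
  obtain ⟨C₂, hC₂⟩ : ∃ C₂ : ℝ, ∀ n : ℕ, r * (n * Real.log 4) ≤ δ * V n + C₂ := by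
    obtain ⟨N, hN⟩ := eventually_atTop.1 (hlim.eventually_ge_atTop (r * Real.log 4 / δ))
    refine ⟨r * (N * Real.log 4), fun n => ?_⟩
    have h4 : 0 < r * Real.log 4 := mul_pos hr (Real.log_pos (by norm_num))
    induction n with
    | zero => simp [hV]; positivity
    | succ n ih =>
      have hs : V (n + 1) = V n + Real.log (u n) := Finset.sum_range_succ _ _
      rcases lt_or_ge n N with hn | hn
      · have h1 : ((n + 1 : ℕ) : ℝ) ≤ N := by exact_mod_cast hn
        have h2 : 0 ≤ V (n + 1) := Finset.sum_nonneg fun j _ => hlog0 j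
        nlinarith [mul_nonneg hδ0.le h2, mul_le_mul_of_nonneg_right h1 h4.le]
      · have h1 := hN n hn
        rw [div_le_iff₀' hδ0] at h1
        rw [hs]; push_cast
        linarith
  refine ⟨(Real.exp (Real.log 2 + r * Real.log 8 + r * C₁ + C₂)).toNNReal, fun n d hd1 hdu => ?_⟩
  have hd0 : 0 < d := by linarith
  have hP : (0 : ℝ) < ∏ j ∈ Finset.range n, (u j : ℝ) := Finset.prod_pos fun j _ => hu0 j
  have hlogP : Real.log (∏ j ∈ Finset.range n, (u j : ℝ)) = V n :=
    Real.log_prod fun j _ => (hu0 j).ne'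
  have hun := hu0 n
  rw [Real.coe_toNNReal _ (Real.exp_pos _).le, ← Real.log_le_log_iff (by positivity) (by positivity),
    Real.log_mul (Real.exp_pos _).ne' (by positivity), Real.log_exp, Real.log_rpow (by positivity),
    Real.log_div (by positivity) (by positivity), Real.log_div (by positivity) (by positivity),
    Real.log_mul (by positivity) (by positivity), Real.log_mul (by positivity) (by positivity),
    Real.log_mul (by positivity) (by positivity), Real.log_mul (by positivity) (by positivity),
    Real.log_mul (by positivity) (by positivity), Real.log_pow, Real.log_pow, Real.log_pow, hlogP]
  have h1 : Real.log d ≤ Real.log (u n) := Real.log_le_log hd0 hdu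
  have h2 := hub n
  have h3 := hC₂ n
  have h4 : (1 - r) * Real.log d ≤ (1 - r) * Real.log (u n) :=
    mul_le_mul_of_nonneg_left h1 (by linarith)
  have h5 : r * Real.log (u n) ≤ r * ((b - 1) * V n + C₁) := mul_le_mul_of_nonneg_left h2 hr.le
  rw [hδ] at h3
  push_cast
  linarith

/-- Lower bound for the dimension of the set of numbers with `u n ≤ a_{n+1} < 2 u n`: the inverse of
`cantorPoint u` is Hölder continuous on this set, for any exponent below `1 / (1 + b)`, and maps
its image onto an interval. -/
theorem le_dimH_of_digits {u : ℕ → ℕ} (hu : ∀ n, 2 ≤ u n) {b C₁ : ℝ} (hb : 1 ≤ b)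
    (hub : ∀ n, Real.log (u n) ≤ (b - 1) * ∑ j ∈ Finset.range n, Real.log (u j) + C₁)
    (hlim : Tendsto (fun n => Real.log (u n)) atTop atTop) :
    ENNReal.ofReal (1 / (1 + b)) ≤ dimH {x : ℝ | x ∈ Ico (0 : ℝ) 1 ∧ Irrational x ∧
      ∀ n, (u n : ℤ) ≤ partialQuotient (n + 1) x ∧ partialQuotient (n + 1) x < 2 * u n} := by
  refine le_of_forall_lt_imp_le_of_dense fun e he => ?_
  obtain ⟨r', her, hr'⟩ := ENNReal.lt_iff_exists_nnreal_btwn.1 he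
  refine her.le.trans ?_
  rcases eq_or_ne r' 0 with rfl | hr0
  · simp
  have hr : (0 : ℝ) < r' := NNReal.coe_pos.2 (pos_iff_ne_zero.2 hr0)
  have hrb : (r' : ℝ) * (1 + b) < 1 := by
    rwa [← ENNReal.ofReal_coe_nnreal, ENNReal.ofReal_lt_ofReal_iff (by positivity),
      lt_div_iff₀ (by linarith)] at hr'
  obtain ⟨C, hC⟩ := exists_holder_constant hu hr hrb (by nlinarith) hub hlim
  have hhol : ∀ y ∈ Ico (0 : ℝ) 1, ∀ y' ∈ Ico (0 : ℝ) 1,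
      |y - y'| ≤ C * |cantorPoint u y - cantorPoint u y'| ^ (r' : ℝ) := by
    intro y hy y' hy'
    rcases eq_or_ne y y' with rfl | hne
    · simp [hr.ne']
    obtain ⟨n, d, h1, h2, h3, h4⟩ := exists_cantorPoint_separation hu hy hy' hne
    refine h3.trans ((hC n d h1 h2).trans ?_)
    have : 0 ≤ d := by linarith
    gcongr
  have hinj : InjOn (cantorPoint u) (Ico 0 1) := fun y hy y' hy' h => by
    have := hhol y hy y' hy'
    rw [h, sub_self, abs_zero, Real.zero_rpow hr.ne', mul_zero] at this
    exact sub_eq_zero.1 (abs_eq_zero.1 (le_antisymm this (abs_nonneg _)))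
  have hinv := hinj.leftInvOn_invFunOn
  have hH : HolderOnWith C r' (Function.invFunOn (cantorPoint u) (Ico 0 1))
      (cantorPoint u '' Ico 0 1) := by
    rintro _ ⟨y, hy, rfl⟩ _ ⟨y', hy', rfl⟩
    rw [hinv hy, hinv hy', edist_dist, edist_dist, Real.dist_eq, Real.dist_eq,
      ENNReal.ofReal_rpow_of_nonneg (abs_nonneg _) hr.le, ← ENNReal.ofReal_coe_nnreal,
      ← ENNReal.ofReal_mul (NNReal.coe_nonneg C)]
    exact ENNReal.ofReal_le_ofReal (hhol y hy y' hy')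
  have hdim := hH.dimH_image_le (pos_iff_ne_zero.2 hr0)
  rw [hinv.image_image, Real.dimH_of_nonempty_interior (by simp), Module.finrank_self,
    Nat.cast_one, ENNReal.le_div_iff_mul_le (by simp [hr0]) (by simp), one_mul] at hdim
  refine hdim.trans (dimH_mono ?_)
  rintro _ ⟨y, hy, rfl⟩
  have ha : ∀ k, 2 ≤ (fun n => u n + radixDigit u n y) k := fun k =>
    (hu k).trans (Nat.le_add_right _ _)
  have hm := cfValue_mem_Icc ha
  refine ⟨⟨hm.1, hm.2.trans_lt (by norm_num)⟩, irrational_cfValue ha, fun n => ?_⟩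
  have := radixDigit_lt (fun n => two_pos.trans_le (hu n)) hy n
  rw [cantorPoint, partialQuotient_cfValue ha]
  constructor
  · exact_mod_cast Nat.le_add_right _ _
  · exact_mod_cast (by omega : u n + radixDigit u n y < 2 * u n)

/-! ### Weighted products and the growth of the product of the digits -/

theorem log_weightedProduct {m : ℕ} (t : Fin (m + 1) → ℝ) {x : ℝ} (hx : Irrational x)
    (h : x ∈ Ico (0 : ℝ) 1) {n : ℕ} (hn : 1 ≤ n) :
    Real.log (weightedProduct t n x) =
      ∑ i : Fin (m + 1), t i * Real.log (partialQuotient (n + i) x) := by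
  have hpos : ∀ i : Fin (m + 1), (0 : ℝ) < partialQuotient (n + i) x := fun i =>
    one_pos.trans_le (one_le_partialQuotient_cast hx h (by omega))
  rw [weightedProduct, Real.log_prod fun i _ => (Real.rpow_pos_of_pos (hpos i) _).ne']
  exact Finset.sum_congr rfl fun i _ => Real.log_rpow (hpos i) _

theorem sum_pos_of_ne {m : ℕ} {t : Fin (m + 1) → ℝ} (ht_nonneg : ∀ i, 0 ≤ t i)
    (ht_ne : ∃ i, t i ≠ 0) : 0 < ∑ i, t i :=
  let ⟨i, hi⟩ := ht_ne
  Finset.sum_pos' (fun i _ => ht_nonneg i)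
    ⟨i, Finset.mem_univ i, lt_of_le_of_ne (ht_nonneg i) hi.symm⟩

theorem eventually_mul_le_of_tendsto_div {φ : ℕ → ℝ}
    (hφ : Tendsto (fun n : ℕ => φ n / (n : ℝ)) atTop atTop) (K : ℝ) :
    ∀ᶠ n : ℕ in atTop, K * n ≤ φ n := by
  filter_upwards [hφ.eventually_ge_atTop K, eventually_gt_atTop 0] with n h hn
  rwa [le_div_iff₀ (by exact_mod_cast hn)] at h

theorem tendsto_of_tendsto_div {φ : ℕ → ℝ}
    (hφ : Tendsto (fun n : ℕ => φ n / (n : ℝ)) atTop atTop) : Tendsto φ atTop atTop :=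
  tendsto_atTop_mono' _ 
    ((eventually_mul_le_of_tendsto_div hφ 1).mono fun n h => by rwa [one_mul] at h)
    tendsto_natCast_atTop_atTop

theorem eventually_le_pow_of_lt {φ : ℕ → ℝ} {B : ENNReal}
    (hB : ENNReal.log B = limsup (fun n : ℕ => ((Real.log (φ n) / (n : ℝ) : ℝ) : EReal)) atTop)
    (hpos : ∀ᶠ n in atTop, 0 < φ n) {b : ℝ} (hb : 0 < b) (h : B < ENNReal.ofReal b) :
    ∀ᶠ n in atTop, φ n ≤ b ^ n := by
  rw [← ENNReal.log_lt_log_iff, hB, ENNReal.log_ofReal_of_pos hb] at h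
  filter_upwards [eventually_lt_of_limsup_lt h, hpos, eventually_gt_atTop 0] with n h1 h2 h3
  rw [EReal.coe_lt_coe_iff, div_lt_iff₀ (by exact_mod_cast h3)] at h1
  rw [← Real.log_le_log_iff h2 (by positivity), Real.log_pow]
  linarith

theorem le_of_eventually_le_mul_pow {φ : ℕ → ℝ} {B : ENNReal}
    (hB : ENNReal.log B = limsup (fun n : ℕ => ((Real.log (φ n) / (n : ℝ) : ℝ) : EReal)) atTop)
    (hpos : ∀ᶠ n in atTop, 0 < φ n) {A c : ℝ} (hc : 0 < c)
    (h : ∀ᶠ n in atTop, φ n ≤ A * c ^ n) : B ≤ ENNReal.ofReal c := by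
  by_contra! hcB
  obtain ⟨c', h1, h2⟩ := ENNReal.lt_iff_exists_nnreal_btwn.1 hcB
  rw [← ENNReal.ofReal_coe_nnreal] at h1 h2
  have hcc : c < c' := (ENNReal.ofReal_lt_ofReal_iff_of_nonneg hc.le).1 h1
  have hc' : (0 : ℝ) < c' := hc.trans hcc
  have hlim : Tendsto (fun n : ℕ => A * (c / c') ^ n) atTop (nhds 0) := by
    simpa using (tendsto_pow_atTop_nhds_zero_of_lt_one (by positivity)
      ((div_lt_one hc').2 hcc)).const_mul A
  refine h2.not_ge ?_
  rw [← ENNReal.log_le_log_iff, hB, ENNReal.log_ofReal_of_pos hc']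
  refine limsup_le_of_le (h := ?_)
  filter_upwards [h, hpos, eventually_gt_atTop 0, hlim.eventually_le_const one_pos]
    with n h1 h2 h3 h4
  rw [EReal.coe_le_coe_iff, div_le_iff₀ (by exact_mod_cast h3), mul_comm, ← Real.log_pow]
  refine Real.log_le_log h2 (h1.trans ?_)
  rwa [div_pow, ← mul_div_assoc, div_le_one (by positivity)] at h4

/-- `log (a_1 ⋯ a_p)`, as a sum. -/
noncomputable def logDigitSum (x : ℝ) (p : ℕ) : ℝ :=
  ∑ j ∈ Finset.range p, Real.log (partialQuotient (j + 1) x)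

theorem exp_logDigitSum {x : ℝ} (hx : Irrational x) (h : x ∈ Ico (0 : ℝ) 1) (p : ℕ) :
    Real.exp (logDigitSum x p) = ∏ j ∈ Finset.range p, (partialQuotient (j + 1) x : ℝ) := by
  rw [logDigitSum, Real.exp_sum]
  exact Finset.prod_congr rfl fun j _ =>
    Real.exp_log (one_pos.trans_le (one_le_partialQuotient_cast hx h (by omega)))

theorem logDigitSum_nonneg {x : ℝ} (hx : Irrational x) (h : x ∈ Ico (0 : ℝ) 1) (p : ℕ) :
    0 ≤ logDigitSum x p :=
  Finset.sum_nonneg fun _ _ => Real.log_nonneg (one_le_partialQuotient_cast hx h (by omega))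

/-- Every digit in the weighted product at `n` is a factor of `a_1 ⋯ a_{n+m}`, so a lower bound for
the weighted product is a lower bound for the product of all digits. -/
theorem eventually_le_logDigitSum {φ : ℕ → ℝ} (hpos : ∀ᶠ n in atTop, 0 < φ n)
    {m : ℕ} {t : Fin (m + 1) → ℝ} (ht_nonneg : ∀ i, 0 ≤ t i) {x : ℝ} (hx : x ∈ liminfSet t φ) :
    ∀ᶠ n in atTop, φ n ≤ 2 * (∑ i, t i) * logDigitSum x (n + m) := by
  obtain ⟨h01, hirr, hlim⟩ := hx
  have hlt : (((1 / 2 : ℝ)) : EReal) <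
      liminf (fun n : ℕ => ((Real.log (weightedProduct t n x) / φ n : ℝ) : EReal)) atTop := by
    rw [hlim]; exact_mod_cast (by norm_num : (1 / 2 : ℝ) < 1)
  filter_upwards [eventually_lt_of_lt_liminf hlt, hpos, eventually_ge_atTop 1] with n h1 h2 h3
  rw [EReal.coe_lt_coe_iff, lt_div_iff₀ h2, log_weightedProduct t hirr h01 h3] at h1
  have h4 : ∑ i : Fin (m + 1), t i * Real.log (partialQuotient (n + i) x) ≤
      (∑ i, t i) * logDigitSum x (n + m) := by
    rw [Finset.sum_mul]
    refine Finset.sum_le_sum fun i _ => mul_le_mul_of_nonneg_left ?_ (ht_nonneg i)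
    obtain ⟨k, hk⟩ := Nat.exists_eq_add_of_le' (h3.trans (Nat.le_add_right n (i : ℕ)))
    rw [hk]
    exact Finset.single_le_sum (f := fun j => Real.log (partialQuotient (j + 1) x))
      (fun j _ => Real.log_nonneg (one_le_partialQuotient_cast hirr h01 (by omega)))
      (Finset.mem_range.2 (by omega))
  linarith

theorem eventually_mul_le_logDigitSum {φ : ℕ → ℝ}
    (hφ : Tendsto (fun n : ℕ => φ n / (n : ℝ)) atTop atTop)
    {m : ℕ} {t : Fin (m + 1) → ℝ} (ht_nonneg : ∀ i, 0 ≤ t i) (ht_ne : ∃ i, t i ≠ 0)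
    {x : ℝ} (hx : x ∈ liminfSet t φ) (K : ℝ) :
    ∀ᶠ p : ℕ in atTop, K * p ≤ logDigitSum x p := by
  have hτ := sum_pos_of_ne ht_nonneg ht_ne
  have hpos := (tendsto_of_tendsto_div hφ).eventually_gt_atTop 0
  filter_upwards [(tendsto_sub_atTop_nat m).eventually
    ((eventually_le_logDigitSum hpos ht_nonneg hx).and
      (eventually_mul_le_of_tendsto_div hφ (4 * (∑ i, t i) * |K|))), eventually_ge_atTop (2 * m)]
    with p hp hpm
  obtain ⟨h1, h2⟩ := hp
  rw [Nat.sub_add_cancel (by omega)] at h1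
  have h3 : (p : ℝ) ≤ 2 * ((p - m : ℕ) : ℝ) := by exact_mod_cast (by omega : p ≤ 2 * (p - m))
  have h4 : (∑ i, t i) * (2 * |K| * (p - m : ℕ)) ≤ (∑ i, t i) * logDigitSum x p := by linarith
  have h5 := le_of_mul_le_mul_left h4 hτ
  have h6 : K * p ≤ |K| * p := mul_le_mul_of_nonneg_right (le_abs_self K) (Nat.cast_nonneg p)
  have h7 := mul_le_mul_of_nonneg_left h3 (abs_nonneg K)
  linarith

/-- If eventually `L (p + 1) < c L p` for `L = logDigitSum x`, then `φ` would be `O (c ^ n)`. -/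
theorem frequently_mul_le_logDigitSum_succ {φ : ℕ → ℝ}
    (hφ : Tendsto (fun n : ℕ => φ n / (n : ℝ)) atTop atTop) {B : ENNReal}
    (hB : ENNReal.log B = limsup (fun n : ℕ => ((Real.log (φ n) / (n : ℝ) : ℝ) : EReal)) atTop)
    {m : ℕ} {t : Fin (m + 1) → ℝ} (ht_nonneg : ∀ i, 0 ≤ t i) (ht_ne : ∃ i, t i ≠ 0)
    {c : ℝ} (hc : 0 < c) (hcB : c = 1 ∨ ENNReal.ofReal c < B) {x : ℝ} (hx : x ∈ liminfSet t φ) :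
    ∃ᶠ p : ℕ in atTop, c * logDigitSum x p ≤ logDigitSum x (p + 1) := by
  obtain ⟨h01, hirr, -⟩ := id hx
  have hnn := logDigitSum_nonneg hirr h01
  have hpos := (tendsto_of_tendsto_div hφ).eventually_gt_atTop 0
  rcases hcB with rfl | hcB
  · refine Frequently.of_forall fun p => ?_
    rw [one_mul, logDigitSum, logDigitSum, Finset.sum_range_succ]
    exact le_add_of_nonneg_right (Real.log_nonneg (one_le_partialQuotient_cast hirr h01 (by omega)))
  · intro hev
    obtain ⟨N, hN⟩ := eventually_atTop.1 hev
    have hgeo : ∀ k, logDigitSum x (N + k) ≤ logDigitSum x N * c ^ k := fun k => by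
      induction k with
      | zero => simp
      | succ k ih =>
        have h1 := (not_le.1 (hN (N + k) (by omega))).le
        rw [← add_assoc, pow_succ]
        calc _ ≤ c * logDigitSum x (N + k) := h1
          _ ≤ c * (logDigitSum x N * c ^ k) := mul_le_mul_of_nonneg_left ih hc.le
          _ = _ := by ring
    refine hcB.not_ge (le_of_eventually_le_mul_pow hB hpos (A := 2 * (∑ i, t i) *
      (logDigitSum x N / c ^ N * c ^ m)) hc ?_)
    filter_upwards [eventually_le_logDigitSum hpos ht_nonneg hx, eventually_ge_atTop N]
      with n h1 h2
    obtain ⟨k, rfl⟩ := Nat.exists_eq_add_of_le h2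
    refine h1.trans ?_
    rw [mul_assoc _ _ (c ^ (N + k))]
    refine mul_le_mul_of_nonneg_left ?_ (mul_nonneg two_pos.le (sum_pos_of_ne ht_nonneg ht_ne).le)
    have h3 := hgeo (k + m)
    rw [← add_assoc] at h3
    refine h3.trans_eq ?_
    rw [pow_add, pow_add]
    field_simp

theorem dimH_liminfSet_le {φ : ℕ → ℝ}
    (hφ : Tendsto (fun n : ℕ => φ n / (n : ℝ)) atTop atTop) {B : ENNReal}
    (hB : ENNReal.log B = limsup (fun n : ℕ => ((Real.log (φ n) / (n : ℝ) : ℝ) : EReal)) atTop)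
    {m : ℕ} {t : Fin (m + 1) → ℝ} (ht_nonneg : ∀ i, 0 ≤ t i) (ht_ne : ∃ i, t i ≠ 0)
    {c : ℝ} (hc : 0 < c) (hcB : c = 1 ∨ ENNReal.ofReal c < B) :
    dimH (liminfSet t φ) ≤ ENNReal.ofReal (1 / (1 + c)) := by
  refine dimH_le_of_frequently_large hc.le (fun x hx => hx.1) (fun x hx => hx.2.1)
    (fun x hx K => ?_) fun x hx => ?_
  · filter_upwards [eventually_mul_le_logDigitSum hφ ht_nonneg ht_ne hx K] with p hp
    rw [← exp_logDigitSum hx.2.1 hx.1]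
    exact Real.exp_le_exp.2 hp
  · refine (frequently_mul_le_logDigitSum_succ hφ hB ht_nonneg ht_ne hc hcB hx).mono fun p hp => ?_
    have h1 := one_pos.trans_le (one_le_partialQuotient_cast hx.2.1 hx.1 (Nat.le_add_left 1 p))
    rw [← exp_logDigitSum hx.2.1 hx.1, ← Real.exp_mul, ← Real.le_log_iff_exp_le h1]
    rw [logDigitSum, logDigitSum, Finset.sum_range_succ] at hp
    rw [logDigitSum]
    linarith

/-! ### A digit growth rate adapted to `φ` -/

theorem liminf_coe_eq_iff (g : ℕ → ℝ) (l : ℝ) :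
    liminf (fun n => (g n : EReal)) atTop = l ↔
      (∀ r < l, ∀ᶠ n in atTop, r < g n) ∧ ∀ r > l, ∃ᶠ n in atTop, g n < r := by
  constructor
  · intro h
    refine ⟨fun r hr => ?_, fun r hr => ?_⟩
    · have : (r : EReal) < liminf (fun n => (g n : EReal)) atTop := by
        rw [h]; exact_mod_cast hr
      exact (eventually_lt_of_lt_liminf this).mono fun n hn => by exact_mod_cast hn
    · have : liminf (fun n => (g n : EReal)) atTop < r := by
        rw [h]; exact_mod_cast hr
      exact (frequently_lt_of_liminf_lt (h := this)).mono fun n hn => by exact_mod_cast hn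
  · rintro ⟨h1, h2⟩
    refine le_antisymm ?_ ?_
    · refine EReal.le_of_forall_lt_iff_le.1 fun r hr => ?_
      refine liminf_le_of_frequently_le ((h2 r (by exact_mod_cast hr)).mono fun n hn => ?_)
      exact_mod_cast hn.le
    · refine EReal.ge_of_forall_gt_iff_ge.1 fun r hr => ?_
      refine le_liminf_of_le (h := (h1 r (by exact_mod_cast hr)).mono fun n hn => ?_)
      exact_mod_cast hn.le

theorem liminf_coe_eq_of_tendsto_sub {g h : ℕ → ℝ} {l : ℝ}
    (hg : liminf (fun n => (g n : EReal)) atTop = l)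
    (hgh : Tendsto (fun n => h n - g n) atTop (nhds 0)) :
    liminf (fun n => (h n : EReal)) atTop = l := by
  rw [liminf_coe_eq_iff] at hg ⊢
  refine ⟨fun r hr => ?_, fun r hr => ?_⟩
  · filter_upwards [hg.1 ((r + l) / 2) (by linarith),
      hgh.eventually_const_lt (show -((l - r) / 2) < 0 by linarith)] with n h1 h2
    linarith
  · refine ((hg.2 ((r + l) / 2) (by linarith)).and_eventually
      (hgh.eventually_lt_const (show 0 < (r - l) / 2 by linarith))).mono fun n hn => ?_
    linarith [hn.1, hn.2]

theorem liminf_coe_div_eq_one {g : ℕ → ℝ} {l : ℝ} (hl : 0 < l)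
    (hg : liminf (fun n => (g n : EReal)) atTop = l) :
    liminf (fun n => ((g n / l : ℝ) : EReal)) atTop = 1 := by
  rw [← EReal.coe_one]
  rw [liminf_coe_eq_iff] at hg ⊢
  refine ⟨fun r hr => ?_, fun r hr => ?_⟩
  · exact (hg.1 (r * l) (by nlinarith)).mono fun n hn => (lt_div_iff₀ hl).2 hn
  · exact (hg.2 (r * l) (by nlinarith)).mono fun n hn => (div_lt_iff₀ hl).2 hn

/-- The supremum of `φ n / b ^ n` over `n ≥ k`; meaningful only when this sequence is bounded. -/
noncomputable def tailSup (φ : ℕ → ℝ) (b : ℝ) (k : ℕ) : ℝ := ⨆ j : ℕ, φ (k + j) / b ^ (k + j)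

section tailSup

variable {φ : ℕ → ℝ} {b : ℝ}

theorem bddAbove_tail (h : BddAbove (range fun n => φ n / b ^ n)) (k : ℕ) :
    BddAbove (range fun j => φ (k + j) / b ^ (k + j)) :=
  h.mono (range_subset_iff.2 fun j => mem_range_self (f := fun n => φ n / b ^ n) (k + j))

theorem le_tailSup (h : BddAbove (range fun n => φ n / b ^ n)) {k n : ℕ} (hkn : k ≤ n) :
    φ n / b ^ n ≤ tailSup φ b k := by
  obtain ⟨j, rfl⟩ := Nat.exists_eq_add_of_le hkn
  exact le_ciSup (bddAbove_tail h k) j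

theorem tailSup_antitone (h : BddAbove (range fun n => φ n / b ^ n)) :
    Antitone (tailSup φ b) := fun _ _ hkl =>
  ciSup_le fun _ => le_tailSup h (hkl.trans (Nat.le_add_right _ _))

/-- The tail supremum decreases at most exponentially, hence cannot drop by a large factor on each
window of length `m`; so infinitely often `φ n / b ^ n` is comparable to the tail supremum at
`n - m`. -/
theorem frequently_tailSup_le (hb : 1 < b) (hφ : Tendsto φ atTop atTop)
    (h : BddAbove (range fun n => φ n / b ^ n)) (m : ℕ) :
    ∃ᶠ n in atTop, b ^ n * tailSup φ b (n - m) ≤ (b ^ m + 1) * φ n := by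
  have hb0 : 0 < b := one_pos.trans hb
  intro hev
  obtain ⟨N, hN⟩ := eventually_atTop.1 (hev.and (hφ.eventually_ge_atTop 1))
  set C : ℝ := b ^ m + 1 with hC
  have hC0 : 0 < C := by positivity
  have hdrop : ∀ k, N ≤ k → tailSup φ b k ≤ tailSup φ b (k - m) / C := by
    intro k hk
    refine ciSup_le fun j => ?_
    have h1 := (not_le.1 (hN (k + j) (by omega)).1).le
    have h2 := tailSup_antitone h (show k - m ≤ k + j - m by omega)
    rw [div_le_div_iff₀ (by positivity) hC0]
    calc φ (k + j) * C = C * φ (k + j) := mul_comm _ _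
      _ ≤ b ^ (k + j) * tailSup φ b (k + j - m) := h1
      _ ≤ b ^ (k + j) * tailSup φ b (k - m) := by gcongr
      _ = _ := mul_comm _ _
  have hiter : ∀ j, tailSup φ b (N + j * m) ≤ tailSup φ b N / C ^ j := by
    intro j
    induction j with
    | zero => simp
    | succ j ih =>
      have h1 := hdrop (N + (j + 1) * m) (by omega)
      rw [show N + (j + 1) * m - m = N + j * m by rw [add_mul, one_mul]; omega] at h1
      rw [pow_succ, ← div_div]
      exact h1.trans (by gcongr)
  have hlim : Tendsto (fun j : ℕ => (C / b ^ m) ^ j) atTop atTop :=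
    tendsto_pow_atTop_atTop_of_one_lt ((one_lt_div (by positivity)).2 (by linarith))
  obtain ⟨j, hj⟩ := (hlim.eventually_gt_atTop (tailSup φ b N * b ^ N)).exists
  have h1 := (le_tailSup h le_rfl).trans (hiter j)
  have h2 := (hN (N + j * m) (by omega)).2
  rw [div_le_div_iff₀ (by positivity) (by positivity)] at h1
  rw [div_pow, lt_div_iff₀ (by positivity), ← pow_mul, mul_assoc, ← pow_add, mul_comm m j] at hj
  have h3 : 1 * C ^ j ≤ φ (N + j * m) * C ^ j := by gcongr
  linarith

end tailSup

/-- A growth rate `ψ` for the logarithms of the digits. The tail suprema give a rate whose weighted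
sums are eventually at least, and infinitely often at most, a constant times `φ`; dividing by the
resulting limit inferior makes it equal to `1`. -/
theorem exists_digit_growth {φ : ℕ → ℝ} (hφ : Tendsto φ atTop atTop) {b : ℝ} (hb : 1 < b)
    (hφb : ∀ᶠ n in atTop, φ n ≤ b ^ n)
    {m : ℕ} {t : Fin (m + 1) → ℝ} (ht_nonneg : ∀ i, 0 ≤ t i) (ht_ne : ∃ i, t i ≠ 0) :
    ∃ ψ : ℕ → ℝ, (∀ n, 0 < ψ n) ∧ (∀ n, ψ (n + 1) ≤ b * ψ n) ∧ Tendsto ψ atTop atTop ∧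
      liminf (fun n => (((∑ i : Fin (m + 1), t i * ψ (n + i)) / φ n : ℝ) : EReal)) atTop = 1 := by
  have hb0 : 0 < b := one_pos.trans hb
  have hbdd : BddAbove (range fun n => φ n / b ^ n) := by
    refine IsBoundedUnder.bddAbove_range ⟨1, eventually_map.2 (hφb.mono fun n hn => ?_)⟩
    exact (div_le_one (by positivity)).2 hn
  have hanti := tailSup_antitone hbdd
  have hMpos : ∀ k, 0 < tailSup φ b k := fun k => by
    obtain ⟨n, h1, h2⟩ := ((hφ.eventually_gt_atTop 0).and (eventually_ge_atTop k)).exists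
    exact (div_pos h1 (by positivity)).trans_le (le_tailSup hbdd h2)
  set ψ : ℕ → ℝ := fun n => b ^ n * tailSup φ b (n - m) with hψ
  have hψpos : ∀ n, 0 < ψ n := fun n => mul_pos (by positivity) (hMpos _)
  have hψφ : ∀ n, φ n ≤ ψ n := fun n => by
    have := le_tailSup hbdd (Nat.sub_le n m)
    rwa [div_le_iff₀' (by positivity)] at this
  have hψsucc : ∀ n, ψ (n + 1) ≤ b * ψ n := fun n => by
    have h1 : tailSup φ b (n + 1 - m) ≤ tailSup φ b (n - m) := hanti (by omega)
    calc ψ (n + 1) ≤ b ^ (n + 1) * tailSup φ b (n - m) := by simp only [hψ]; gcongr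
      _ = b * ψ n := by simp only [hψ]; ring
  set g : ℕ → ℝ := fun n => (∑ i : Fin (m + 1), t i * ψ (n + i)) / φ n with hg
  obtain ⟨i₀, hi₀⟩ := ht_ne
  have hti₀ : 0 < t i₀ := lt_of_le_of_ne (ht_nonneg i₀) hi₀.symm
  have hlow : ((t i₀ : ℝ) : EReal) ≤ liminf (fun n => (g n : EReal)) atTop := by
    refine le_liminf_of_le (h := ?_)
    filter_upwards [hφ.eventually_gt_atTop 0] with n hn
    rw [EReal.coe_le_coe_iff, hg, le_div_iff₀ hn]
    have h1 : φ n ≤ ψ (n + i₀) := by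
      have h2 := le_tailSup hbdd (show n + i₀ - m ≤ n by omega)
      rw [div_le_iff₀' (by positivity)] at h2
      refine h2.trans (mul_le_mul_of_nonneg_right ?_ (hMpos _).le)
      exact pow_le_pow_right₀ hb.le (Nat.le_add_right _ _)
    calc t i₀ * φ n ≤ t i₀ * ψ (n + i₀) := by gcongr
      _ ≤ _ := Finset.single_le_sum (f := fun i : Fin (m + 1) => t i * ψ (n + i))
        (fun i _ => mul_nonneg (ht_nonneg i) (hψpos _).le) (Finset.mem_univ i₀)
  have hup : liminf (fun n => (g n : EReal)) atTop ≤
      (((∑ i, t i) * (b ^ m * (b ^ m + 1)) : ℝ) : EReal) := by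
    refine liminf_le_of_frequently_le (((frequently_tailSup_le hb hφ hbdd m).and_eventually
      (hφ.eventually_gt_atTop 0)).mono fun n hn => ?_)
    obtain ⟨h1, h2⟩ := hn
    rw [EReal.coe_le_coe_iff, hg, div_le_iff₀ h2, Finset.sum_mul, Finset.sum_mul]
    refine Finset.sum_le_sum fun i _ => ?_
    have h3 : ψ (n + i) ≤ b ^ m * (b ^ n * tailSup φ b (n - m)) := by
      rw [← mul_assoc, ← pow_add]
      exact mul_le_mul (pow_le_pow_right₀ hb.le (by omega)) (hanti (by omega)) (hMpos _).le
        (by positivity)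
    have h4 := ht_nonneg i
    calc t i * ψ (n + i) ≤ t i * (b ^ m * ((b ^ m + 1) * φ n)) := by
          gcongr; exact h3.trans (by gcongr)
      _ = _ := by ring
  obtain ⟨l, hl⟩ : ∃ l : ℝ, liminf (fun n => (g n : EReal)) atTop = l :=
    ⟨_, (EReal.coe_toReal (ne_top_of_le_ne_top (EReal.coe_ne_top _) hup)
      (ne_bot_of_le_ne_bot (EReal.coe_ne_bot _) hlow)).symm⟩
  have hl0 : 0 < l := by
    rw [hl, EReal.coe_le_coe_iff] at hlow
    linarith
  refine ⟨fun n => ψ n / l, fun n => div_pos (hψpos n) hl0, fun n => ?_,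
    (tendsto_atTop_mono hψφ hφ).atTop_div_const hl0, ?_⟩
  · rw [← mul_div_assoc]
    exact div_le_div_of_nonneg_right (hψsucc n) hl0.le
  · convert liminf_coe_div_eq_one hl0 hl using 4 with n
    have : ∑ i : Fin (m + 1), t i * (ψ (n + i) / l) = (∑ i : Fin (m + 1), t i * ψ (n + i)) / l := by
      simp only [Finset.sum_div, mul_div_assoc]
    rw [this, div_right_comm]

theorem le_dimH_liminfSet {φ : ℕ → ℝ} (hφ : Tendsto φ atTop atTop) {b : ℝ} (hb : 1 < b)
    (hφb : ∀ᶠ n in atTop, φ n ≤ b ^ n)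
    {m : ℕ} {t : Fin (m + 1) → ℝ} (ht_nonneg : ∀ i, 0 ≤ t i) (ht_ne : ∃ i, t i ≠ 0) :
    ENNReal.ofReal (1 / (1 + b)) ≤ dimH (liminfSet t φ) := by
  obtain ⟨ψ, hψ0, hψb, hψlim, hlim⟩ := exists_digit_growth hφ hb hφb ht_nonneg ht_ne
  set u : ℕ → ℕ := fun n => ⌈Real.exp (ψ (n + 1))⌉₊ with hu
  have hexp : ∀ n, 1 < Real.exp (ψ (n + 1)) := fun n => Real.one_lt_exp_iff.2 (hψ0 _)
  have hu2 : ∀ n, 2 ≤ u n := fun n => by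
    have : 1 < u n := Nat.lt_ceil.2 (by exact_mod_cast hexp n)
    omega
  have hu0 : ∀ n, (0 : ℝ) < u n := fun n => by exact_mod_cast two_pos.trans_le (hu2 n)
  have hlow : ∀ n, ψ (n + 1) ≤ Real.log (u n) := fun n =>
    (Real.le_log_iff_exp_le (hu0 n)).2 (Nat.le_ceil _)
  have hup : ∀ n, Real.log (u n) ≤ ψ (n + 1) + Real.log 2 := fun n => by
    rw [Real.log_le_iff_le_exp (hu0 n), Real.exp_add, Real.exp_log two_pos]
    have h1 := Nat.ceil_lt_add_one (Real.exp_pos (ψ (n + 1))).le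
    have h2 := hexp n
    exact le_of_lt (h1.trans (by linarith))
  have hsum : ∀ n, ψ (n + 1) ≤ (b - 1) * ∑ j ∈ Finset.range n, ψ (j + 1) + ψ 1 := fun n => by
    induction n with
    | zero => simp
    | succ n ih =>
      rw [Finset.sum_range_succ]
      linarith [hψb (n + 1)]
  refine (le_dimH_of_digits hu2 hb.le (C₁ := ψ 1 + Real.log 2) (fun n => ?_)
    (tendsto_atTop_mono hlow ((tendsto_add_atTop_iff_nat 1).2 hψlim))).trans (dimH_mono ?_)
  · have h1 : (b - 1) * ∑ j ∈ Finset.range n, ψ (j + 1) ≤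
        (b - 1) * ∑ j ∈ Finset.range n, Real.log (u j) :=
      mul_le_mul_of_nonneg_left (Finset.sum_le_sum fun j _ => hlow j) (by linarith)
    linarith [hup n, hsum n]
  · rintro x ⟨h01, hirr, hx⟩
    refine ⟨h01, hirr, ?_⟩
    have hdig : ∀ n, 1 ≤ n → |Real.log (partialQuotient n x) - ψ n| ≤ 2 * Real.log 2 := by
      intro n hn
      obtain ⟨k, rfl⟩ := Nat.exists_eq_add_of_le' hn
      have h1 : (u k : ℝ) ≤ partialQuotient (k + 1) x := by exact_mod_cast (hx k).1
      have h2 : (partialQuotient (k + 1) x : ℝ) ≤ 2 * u k := by exact_mod_cast (hx k).2.le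
      have h3 := Real.log_le_log (hu0 k) h1
      have h4 := Real.log_le_log ((hu0 k).trans_le h1) h2
      rw [Real.log_mul two_ne_zero (hu0 k).ne'] at h4
      have h5 := Real.log_pos one_lt_two
      rw [abs_le]
      constructor <;> linarith [hlow k, hup k]
    refine liminf_coe_eq_of_tendsto_sub (by exact_mod_cast hlim) ?_
    have hz : Tendsto (fun n => (∑ i, t i) * (2 * Real.log 2) / φ n) atTop (nhds 0) :=
      hφ.const_div_atTop _
    refine squeeze_zero_norm' ?_ hz
    filter_upwards [hφ.eventually_gt_atTop 0, eventually_ge_atTop 1] with n h1 h2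
    rw [log_weightedProduct t hirr h01 h2, ← sub_div, norm_div, Real.norm_of_nonneg h1.le,
      ← Finset.sum_sub_distrib, Finset.sum_mul]
    gcongr
    refine (norm_sum_le _ _).trans (Finset.sum_le_sum fun i _ => ?_)
    rw [← mul_sub, norm_mul, Real.norm_of_nonneg (ht_nonneg i)]
    exact mul_le_mul_of_nonneg_left (hdig (n + i) (by omega)) (ht_nonneg i)

/-! ### The dimension formula -/

theorem ofReal_one_div_one_add (c : NNReal) :
    ENNReal.ofReal (1 / (1 + c)) = (1 + (c : ENNReal))⁻¹ := by
  rw [one_div, ENNReal.ofReal_inv_of_pos (by positivity),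
    ENNReal.ofReal_add zero_le_one (NNReal.coe_nonneg c), ENNReal.ofReal_one, ENNReal.ofReal_coe_nnreal]

theorem theorem1p1 (φ : ℕ → ℝ) (hφ_nonneg : ∀ n, 1 ≤ n → 0 ≤ φ n)
    (hφ : Tendsto (fun n : ℕ => φ n / (n : ℝ)) atTop atTop)
    (B : ENNReal)
    (hB : ENNReal.log B =
      limsup (fun n : ℕ => ((Real.log (φ n) / (n : ℝ) : ℝ) : EReal)) atTop)
    (hB_one : 1 ≤ B)
    (m : ℕ) (t : Fin (m + 1) → ℝ) (ht_nonneg : ∀ i, 0 ≤ t i) (ht_ne : ∃ i, t i ≠ 0) :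
    dimH (liminfSet t φ) = 1 / (1 + B) := by
  have hφ' := tendsto_of_tendsto_div hφ
  rw [one_div]
  refine le_antisymm ?_ ?_
  · refine le_of_forall_gt_imp_ge_of_dense fun e he => ?_
    obtain ⟨c, hc0, hcB, hce⟩ : ∃ c : NNReal, 0 < c ∧ ((c : ℝ) = 1 ∨ ENNReal.ofReal c < B) ∧
        e⁻¹ ≤ 1 + c := by
      rw [ENNReal.inv_lt_iff_inv_lt] at he
      rcases hB_one.eq_or_lt with rfl | hB1
      · exact ⟨1, one_pos, Or.inl rfl, by simpa using he.le⟩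
      · have h1 : max 1 (e⁻¹ - 1) < B := by
          refine max_lt hB1 ?_
          rcases le_total 1 e⁻¹ with h | h
          · exact (ENNReal.sub_lt_iff_lt_left ENNReal.one_ne_top h).2 he
          · rw [tsub_eq_zero_of_le h]
            exact one_pos.trans hB1
        obtain ⟨c, hc1, hc2⟩ := ENNReal.lt_iff_exists_nnreal_btwn.1 h1
        refine ⟨c, ?_, Or.inr (by rwa [ENNReal.ofReal_coe_nnreal]), ?_⟩
        · exact_mod_cast one_pos.trans ((le_max_left _ _).trans_lt hc1)
        · rw [← tsub_le_iff_left]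
          exact (le_max_right _ _).trans hc1.le
    refine (dimH_liminfSet_le hφ hB ht_nonneg ht_ne (NNReal.coe_pos.2 hc0) hcB).trans ?_
    rw [ofReal_one_div_one_add]
    exact ENNReal.inv_le_iff_inv_le.1 hce
  · refine le_of_forall_lt_imp_le_of_dense fun e he => ?_
    rw [ENNReal.lt_inv_iff_lt_inv, ← lt_tsub_iff_left] at he
    obtain ⟨c, hc1, hc2⟩ := ENNReal.lt_iff_exists_nnreal_btwn.1 he
    have hc : (1 : ℝ) < c := by exact_mod_cast hB_one.trans_lt hc1
    refine le_trans ?_ (le_dimH_liminfSet hφ' hc (eventually_le_pow_of_lt hB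
      (hφ'.eventually_gt_atTop 0) (one_pos.trans hc) (by rwa [ENNReal.ofReal_coe_nnreal]))
      ht_nonneg ht_ne)
    rw [ofReal_one_div_one_add, ENNReal.le_inv_iff_le_inv]
    exact (lt_tsub_iff_left.1 hc2).le
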